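/- Let $\mathbb{F}_q$ be a finite field with $q$ elements, let $n \ge 1$ be an integer, let $X/\mathbb{F}_q$ be a smooth, proper, geometrically irreducible curve with function field $\kappa(X)$, and let $u,v\in\kappa(X)$ be separable rational functions, i.e. $\kappa(X)$ is a separable algebraic extension of $\mathbb{F}_q(u)$ and of $\mathbb{F}_q(v)$. The degree of a nonconstant rational function $w \in \kappa(X)$ is the degree of the morphism $X\to\mathbb{P}^1$ it defines, i.e. $[\kappa(X):\mathbb{F}_q(w)]$. Suppose that 1. $\#X(\mathbb{F}_q) = n(q+1)$; 2. $u$ has degree $n(q+1)$ and $v$ has degree $n$; 3. $\kappa(X)=\mathbb{F}_q(u,v)$; and 4. $u$ vanishes at every point of $X(\mathbb{F}_q)$. Then $v$ generates a totally $u$-adic extension of $\mathbb{F}_q(u)$ of degree $n(q+1)$, and the height of $v$ over $\mathbb{F}_q(u)$ is $$h(v)=\frac{1}{q+1}.$$ Here an element $w$ of $\kappa(X)$ algebraic over $\mathbb{F}_q(u)$ is called totally $u$-adic if its minimal polynomial over $\mathbb{F}_q(u)$ splits completely into linear factors over the completion $\mathbb{F}_q((u))$ of $\mathbb{F}_q(u)$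 at $u=0$, and an extension of $\mathbb{F}_q(u)$ inside $\kappa(X)$ is called totally $u$-adic if all its elements (in particular, its generator) are. The height of $v$ is $h(v)=\deg_u(f)/\deg_x(f)$, where $f\in\mathbb{F}_q[u][x]$ is the unique polynomial with root $v$ that is irreducible over $\mathbb{F}_q(u)$, whose coefficients in $\mathbb{F}_q[u]$ have no common factor, and whose leading coefficient is monic. -/

import Mathlib

open AlgebraicGeometry CategoryTheory Polynomial
open scoped IntermediateField LaurentSeries

universe u

/-! ### Curves over a field, rational points, rational functions -/

/-- A smooth, proper, geometrically irreducible curve over the field `F`. -/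
structure SmoothProperCurve (F : Type u) [Field F] where
  /-- the underlying scheme -/
  X : Scheme.{u}
  /-- the structure morphism -/
  π : X ⟶ Spec (CommRingCat.of F)
  smooth : SmoothOfRelativeDimension 1 π
  proper : IsProper π
  geometricallyIrreducible : GeometricallyIrreducible π

/-- An algebra that is étale over a domain is reduced. -/
theorem isReduced_of_etale_of_isDomain {P S : Type u} [CommRing P] [IsDomain P] [CommRing S]
    [Algebra P S] [Algebra.Etale P S] : _root_.IsReduced S := by
  have : Module.Flat P S := Algebra.Smooth.flat P S
  have h1 : _root_.IsReduced (TensorProduct P (FractionRing P) S) :=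
    Algebra.FormallyUnramified.isReduced_of_field (FractionRing P) _
  refine isReduced_of_injective
    (Algebra.TensorProduct.includeRight : S →ₐ[P] TensorProduct P (FractionRing P) S) ?_
  exact Algebra.TensorProduct.includeRight_injective (IsFractionRing.injective P (FractionRing P))

/-- A standard smooth algebra over a domain is reduced. -/
theorem isReduced_of_isStandardSmooth {n : ℕ} {R S : Type u} [CommRing R] [IsDomain R]
    [CommRing S] {f : R →+* S}
    (hf : f.IsStandardSmoothOfRelativeDimension n) : _root_.IsReduced S := by
  obtain ⟨g, -, hg⟩ := hf.exists_etale_mvPolynomial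
  algebraize [g]
  exact isReduced_of_etale_of_isDomain (P := MvPolynomial (Fin n) R)

namespace SmoothProperCurve

variable {F : Type u} [Field F] (C : SmoothProperCurve F)

instance isReduced : IsReduced C.X := by
  have := C.smooth
  refine @isReduced_of_isReduced_stalk _ fun x ↦ ?_
  obtain ⟨U, hU, V, hV, hx, e, h⟩ :=
    SmoothOfRelativeDimension.exists_isStandardSmoothOfRelativeDimension (n := 1) (f := C.π) x
  have : Nonempty U := ⟨⟨_, e hx⟩⟩
  have this1 : _root_.IsReduced Γ(C.X, V) := isReduced_of_isStandardSmooth h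
  let := TopCat.Presheaf.algebra_section_stalk C.X.presheaf (U := V) ⟨x, hx⟩
  have := hV.isLocalization_stalk ⟨x, hx⟩
  exact isReduced_localizationPreserves (R := Γ(C.X, V)) (hV.primeIdealOf ⟨x, hx⟩).asIdeal.primeCompl _ this1

/-- A smooth, geometrically irreducible curve is an integral scheme, so that its function field
is a field. -/
instance isIntegral : IsIntegral C.X := by
  have := C.geometricallyIrreducible
  have : IrreducibleSpace C.X :=
    GeometricallyIrreducible.irreducibleSpace_of_subsingleton C.π
  exact isIntegral_of_irreducibleSpace_of_isReduced _

/-- The function field `κ(X)`. -/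
abbrev functionField : Type u := C.X.functionField

/-- `κ(X)` is an extension of `F` through the structure morphism. -/
noncomputable instance : Algebra F C.functionField :=
  RingHom.toAlgebra ((C.X.presheaf.germ ⊤ (genericPoint C.X) trivial).hom.comp
    ((C.π.appTop).hom.comp (Scheme.ΓSpecIso (CommRingCat.of F)).inv.hom))

/-- The set `X(F)` of `F`-rational points: sections of the structure morphism. -/
def RationalPoint : Type u :=
  {s : Spec (CommRingCat.of F) ⟶ C.X // s ≫ C.π = 𝟙 _}

/-- The point of the scheme `X` underlying a rational point. -/
noncomputable def RationalPoint.point {C : SmoothProperCurve F} (P : C.RationalPoint) : C.X :=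
  P.1 (IsLocalRing.closedPoint F)

/-- The rational function `f` vanishes at `x`: it lies in the maximal ideal of the local ring
of `X` at `x`. -/
def VanishesAt (f : C.functionField) (x : C.X) : Prop :=
  ∃ g ∈ IsLocalRing.maximalIdeal (C.X.presheaf.stalk x),
    algebraMap (C.X.presheaf.stalk x) C.functionField g = f

/-- The degree `[κ(X) : F(f)]` of a rational function `f`, that is, the degree of the morphism
`X → ℙ¹` it defines (and `0` for a constant function). -/
noncomputable def degree (f : C.functionField) : ℕ :=
  Module.finrank F⟮f⟯ C.functionField

/-- The rational function `f` is separable: `κ(X)` is a separable algebraic extension of `F(f)`. -/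
def IsSeparableFunction (f : C.functionField) : Prop :=
  Algebra.IsSeparable F⟮f⟯ C.functionField

end SmoothProperCurve

/-! ### Totally `u`-adic functions and heights -/

section FunctionFieldHeights

variable (F : Type*) {K : Type*} [Field F] [Field K] [Algebra F K]

/-- `v` is totally `u`-adic over `F(u)`: under the embedding `F(u) → F((T))` over `F` with
`u ↦ T` (the completion of `F(u)` at `u = 0`), the minimal polynomial of `v` over `F(u)` splits
completely over `F((T))`. The embedding is unique, and it exists if and only if `u` is
transcendental over `F`. -/
def IsTotallyAdic (u v : K) : Prop :=
  _root_.IsIntegral F⟮u⟯ v ∧ ∃ φ : F⟮u⟯ →ₐ[F] F⸨X⸩,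
    φ (IntermediateField.AdjoinSimple.gen F u) = HahnSeries.single 1 1 ∧
      ((minpoly F⟮u⟯ v).map (φ : F⟮u⟯ →+* F⸨X⸩)).Splits

/-- An intermediate extension `E` of `K / F(u)` is totally `u`-adic: all its elements are. -/
def IsTotallyAdicExtension (u : K) (E : IntermediateField F⟮u⟯ K) : Prop :=
  ∀ w ∈ E, IsTotallyAdic F u w

/-- `f ∈ F[T][x]` is *the* minimal polynomial of `v` over `F[T]`, where `T = u`: it is irreducible
over `F(T)`, has `v` as a root, its coefficients have no common factor, and its leading
coefficient is monic. -/
structure IsMinimalPolynomial (u v : K) (f : F[X][X]) : Prop where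
  irreducible : Irreducible (f.map (algebraMap F[X] (RatFunc F)))
  root : f.eval₂ (aeval u : F[X] →ₐ[F] K).toRingHom v = 0
  primitive : f.IsPrimitive
  monic : f.leadingCoeff.Monic

variable {F} in
/-- The degree in `T` of a polynomial in `F[T][x]`. -/
noncomputable def degT (f : F[X][X]) : ℕ := f.support.sup fun i ↦ (f.coeff i).natDegree

open Classical in
/-- The absolute height `h(v) = deg_T f / deg_x f` of an element `v` algebraic over `F(u)`, where
`f ∈ F[T][x]` is the minimal polynomial of `v`, with `T = u`. -/
noncomputable def height (u v : K) : ℚ :=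
  if h : ∃ f : F[X][X], IsMinimalPolynomial F u v f then
    (degT h.choose : ℚ) / (h.choose.natDegree : ℚ)
  else 0

variable {F} in
/-- Over `F(u)` with `u` transcendental, the minimal polynomial is unique, so that the height is
well defined. -/
theorem IsMinimalPolynomial.unique {u v : K} (hu : Transcendental F u) {f g : F[X][X]}
    (hf : IsMinimalPolynomial F u v f) (hg : IsMinimalPolynomial F u v g) : f = g := by
  have hinj : Function.Injective (aeval u : F[X] →ₐ[F] K) :=
    transcendental_iff_injective.mp hu
  let ψ : RatFunc F →+* K := IsFractionRing.lift (g := (aeval u : F[X] →ₐ[F] K).toRingHom) hinj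
  have hψ (p : F[X][X]) (hp : IsMinimalPolynomial F u v p) :
      eval₂ ψ v (p.map (algebraMap F[X] (RatFunc F))) = 0 := by
    have hc : ψ.comp (algebraMap F[X] (RatFunc F)) = (aeval u : F[X] →ₐ[F] K).toRingHom :=
      RingHom.ext fun a ↦ IsFractionRing.lift_algebraMap hinj a
    rw [eval₂_map, hc, hp.root]
  have key (p q : F[X][X]) (hp : IsMinimalPolynomial F u v p) (hq : IsMinimalPolynomial F u v q) :
      p ∣ q := by
    rw [hp.primitive.dvd_iff_fraction_map_dvd_fraction_map (RatFunc F)]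
    by_contra hn
    have hco := (hp.irreducible.coprime_iff_not_dvd).mpr hn
    obtain ⟨a, b, hab⟩ := hco
    have := congrArg (eval₂ ψ v) hab
    simp [eval₂_add, eval₂_mul, hψ p hp, hψ q hq] at this
  have hass := associated_of_dvd_dvd (key f g hf hg) (key g f hg hf)
  obtain ⟨c, rfl⟩ := hass
  obtain ⟨r, hr, hrc⟩ := Polynomial.isUnit_iff.mp c.isUnit
  have hm := hg.monic
  rw [← hrc, leadingCoeff_mul, leadingCoeff_C] at hm
  obtain ⟨t, -, rfl⟩ := Polynomial.isUnit_iff.mp hr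
  have ht : t = 1 := by
    have h2 := hm.leadingCoeff
    rwa [leadingCoeff_mul, hf.monic.leadingCoeff, one_mul, leadingCoeff_C] at h2
  rw [← hrc, ht]
  simp

end FunctionFieldHeights

/-! Write `K = κ(X)` and `N = n(q+1) = [K : F(u)]`. Over the zeros of `u` the ramification indices
and residue degrees satisfy `∑ eᵢ fᵢ = N`, and the `N` rational points already exhaust this sum. So
each is a simple zero, and `u` is a uniformizer there
(`ValuationSubring.valuation_div_le_one_of_finrank_le_card`).

Expansion in powers of `u` at a rational point embeds `K` into `F((T))` with `u ↦ T`
(`exists_algHom_laurentSeries`). The local ring is the preimage of `F[[T]]`, and by separatedness it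
determines the point (`RationalPoint.eq_of_range_subset`), so the `N` embeddings are distinct. As `K
= F(u, v)`, they send `v` to `N` distinct roots of its minimal polynomial, which has degree `N` and
hence splits; the same then follows for every element of `K`.

For the height, Gauss's lemma makes the primitive equation between `u` and `v` irreducible in either
variable. Its degree in `x` is `[K : F(u)] = N` and its degree in `T` is `[K : F(v)] = n`
(`height_eq_finrank_div_finrank`), with quotient `1/(q+1)`. -/

/-! ### Expansions in a uniformizer -/

section PowerSeriesExpansion

/-- If the kernel of a retraction `ρ : R → F` is generated by a nonzerodivisor `ϖ`, every element
of `R` has a power series expansion in `ϖ`. -/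
theorem exists_algHom_powerSeries {F R : Type*} [Field F] [CommRing R] [IsDomain R] [Algebra F R]
    (ρ : R →ₐ[F] F) {ϖ : R} (hϖ : ϖ ≠ 0) (h : ∀ a, ρ a = 0 ↔ ϖ ∣ a) :
    ∃ φ : R →ₐ[F] PowerSeries F, φ ϖ = PowerSeries.X ∧
      ∀ a, PowerSeries.constantCoeff (φ a) = ρ a := by
  -- `D` removes the constant term and divides by `ϖ`; the `n`-th coefficient of `a` is then `ρ
  -- (D^[n] a)`.
  have hex (a : R) : ∃ d, a - algebraMap F R (ρ a) = ϖ * d := (h _).mp (by simp)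
  choose D hD using hex
  have hDuniq {a d : R} {c : F} (ha : a = algebraMap F R c + ϖ * d) : D a = d := by
    have hc : ρ a = c := by
      rw [ha, map_add, map_mul, (h ϖ).mpr dvd_rfl]; simp
    have := hD a
    rw [hc] at this
    exact mul_left_cancel₀ hϖ (by linear_combination ha - this)
  have hDadd (a b : R) : D (a + b) = D a + D b :=
    hDuniq (c := ρ a + ρ b) (by rw [map_add]; linear_combination hD a + hD b)
  have hDmul (a b : R) : D (a * b) = algebraMap F R (ρ a) * D b + b * D a :=
    hDuniq (c := ρ a * ρ b) (by
      rw [map_mul]; linear_combination b * hD a + algebraMap F R (ρ a) * hD b)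
  have hDC (c : F) : D (algebraMap F R c) = 0 := hDuniq (c := c) (by simp)
  have hD0 : D 0 = 0 := hDuniq (c := 0) (by simp)
  have hDϖ : D ϖ = 1 := hDuniq (c := 0) (by simp)
  have hρϖ : ρ ϖ = 0 := (h ϖ).mpr dvd_rfl
  let co (n : ℕ) (a : R) : F := ρ (D^[n] a)
  have co0 (a) : co 0 a = ρ a := rfl
  have coS (n a) : co (n + 1) a = co n (D a) := rfl
  have coadd (n) : ∀ a b, co n (a + b) = co n a + co n b := by
    induction n with
    | zero => intro a b; simp [co0]
    | succ n ih => intro a b; rw [coS, hDadd, ih, coS, coS]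
  have cosmul (n) : ∀ (c : F) a, co n (algebraMap F R c * a) = c * co n a := by
    induction n with
    | zero => intro c a; simp [co0]
    | succ n ih => intro c a; rw [coS, hDmul, hDC, mul_zero, add_zero, AlgHom.commutes,
        Algebra.algebraMap_self_apply, ih, coS]
  have coC (n) (c : F) : co n (algebraMap F R c) = if n = 0 then c else 0 := by
    cases n with
    | zero => simp [co0]
    | succ n =>
      rw [coS, hDC]
      simpa using cosmul n 0 0
  let φ (a : R) : PowerSeries F := PowerSeries.mk fun n ↦ co n a
  have φeq (a : R) : φ a = PowerSeries.C (ρ a) + PowerSeries.X * φ (D a) := by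
    ext n
    cases n with
    | zero => simp [φ, co0]
    | succ n => simp [φ, coS, PowerSeries.coeff_succ_X_mul]
  -- The twisted Leibniz rule `hDmul` reduces coefficient `n + 1` for `(a, b)` to coefficient `n`
  -- for `(b, D a)`.
  have φmul (a b : R) : φ (a * b) = φ a * φ b := by
    ext n
    induction n generalizing a b with
    | zero => simp [φ, co0]
    | succ n ih =>
      have h1 : PowerSeries.coeff (n + 1) (φ (a * b)) =
          ρ a * co n (D b) + PowerSeries.coeff n (φ (b * D a)) := by
        simp only [φ, PowerSeries.coeff_mk, coS, hDmul, coadd, cosmul]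
      have h2 : φ a * φ b = PowerSeries.C (ρ a) * φ b + PowerSeries.X * (φ b * φ (D a)) := by
        rw [φeq a]; ring
      rw [h1, h2, ih, map_add, PowerSeries.coeff_succ_X_mul, PowerSeries.coeff_C_mul]
      simp [φ, coS]
  have φC (c : F) : φ (algebraMap F R c) = algebraMap F (PowerSeries F) c := by
    ext n
    simp [φ, coC, PowerSeries.coeff_C]
  refine ⟨{ toFun := φ, map_one' := ?_, map_mul' := φmul, map_zero' := ?_, map_add' := ?_,
            commutes' := φC }, ?_, ?_⟩
  · simpa using φC 1
  · simpa using φC 0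
  · intro a b; ext n; simp [φ, coadd]
  · change φ ϖ = _
    rw [φeq, hρϖ, hDϖ]
    have := φC 1
    rw [map_one, map_one] at this
    simp [this]
  · intro a; change PowerSeries.constantCoeff (φ a) = _; simp [φ, co0]

/-- The field of fractions of a discrete valuation ring with uniformizer `ϖ` and a retraction onto
its coefficient field `F` embeds into `F((T))`, with `ϖ ↦ T`, so that nonintegral elements do not
become power series. -/
theorem exists_algHom_laurentSeries {F R K : Type*} [Field F] [CommRing R] [IsDomain R]
    [IsDiscreteValuationRing R] [Algebra F R] [Field K] [Algebra R K] [IsFractionRing R K]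
    [Algebra F K] [IsScalarTower F R K]
    (ρ : R →ₐ[F] F) {ϖ : R} (hϖ : Irreducible ϖ) :
    ∃ φ : K →ₐ[F] F⸨X⸩, φ (algebraMap R K ϖ) = HahnSeries.single 1 1 ∧
      ∀ x, x ∈ Set.range (algebraMap R K) ↔
        φ x ∈ Set.range (algebraMap (PowerSeries F) F⸨X⸩) := by
  have hker (a : R) : ρ a = 0 ↔ ϖ ∣ a := by
    rw [← Ideal.mem_span_singleton, ← (IsDiscreteValuationRing.irreducible_iff_uniformizer ϖ).mp hϖ,
      ← RingHom.mem_ker]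
    have : (RingHom.ker ρ).IsMaximal := RingHom.ker_isMaximal_of_surjective ρ
      fun c ↦ ⟨algebraMap F R c, by simp⟩
    rw [IsLocalRing.eq_maximalIdeal this]
  obtain ⟨φ, hφϖ, hφ0⟩ := exists_algHom_powerSeries ρ hϖ.ne_zero hker
  have hinj : Function.Injective φ := by
    rw [injective_iff_map_eq_zero]
    intro a ha
    by_contra h0
    obtain ⟨n, w, rfl⟩ := IsDiscreteValuationRing.eq_unit_mul_pow_irreducible h0 hϖ
    rw [map_mul, map_pow, hφϖ] at ha
    rcases mul_eq_zero.mp ha with h1 | h1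
    · exact (w.isUnit.map φ).ne_zero h1
    · exact pow_ne_zero n PowerSeries.X_ne_zero h1
  let ι : PowerSeries F →ₐ[F] F⸨X⸩ :=
    { algebraMap (PowerSeries F) F⸨X⸩ with
      commutes' := fun c ↦ by
        simp [LaurentSeries.algebraMap_apply] }
  let ψ₀ : R →ₐ[F] F⸨X⸩ := ι.comp φ
  have hψ₀ : Function.Injective ψ₀ :=
    (FaithfulSMul.algebraMap_injective (PowerSeries F) F⸨X⸩).comp hinj
  let ψ : K →ₐ[F] F⸨X⸩ := IsFractionRing.liftAlgHom (K := K) hψ₀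
  have hψ (a : R) : ψ (algebraMap R K a) = algebraMap (PowerSeries F) F⸨X⸩ (φ a) := by
    rw [IsFractionRing.liftAlgHom_apply, IsFractionRing.lift_algebraMap]; rfl
  refine ⟨ψ, ?_, fun x ↦ ⟨?_, ?_⟩⟩
  · rw [hψ, hφϖ]
    simp
  · rintro ⟨a, rfl⟩
    exact ⟨_, (hψ a).symm⟩
  -- If `x` is not in `R`, its inverse `y` is in the maximal ideal, so `φ y` has no constant term
  -- and cannot have the power series `s` as inverse.
  · rintro ⟨s, hs⟩
    by_contra hx
    rcases ValuationRing.isInteger_or_isInteger R x with h1 | ⟨y, hy⟩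
    · exact hx h1
    have hx0 : x ≠ 0 := by rintro rfl; exact hx ⟨0, by simp⟩
    have hyu : ¬ IsUnit y := by
      rintro ⟨w, rfl⟩
      refine hx ⟨(w⁻¹ : Rˣ), ?_⟩
      rw [← inv_inv x, ← hy, map_units_inv]
    have hρ : ρ y = 0 := by
      rw [hker, ← Ideal.mem_span_singleton,
        ← (IsDiscreteValuationRing.irreducible_iff_uniformizer ϖ).mp hϖ]
      exact hyu
    have h1 : algebraMap (PowerSeries F) F⸨X⸩ (s * φ y) = algebraMap (PowerSeries F) F⸨X⸩ 1 := by
      rw [map_mul, hs, ← hψ, hy, ← map_mul, mul_inv_cancel₀ hx0, map_one, map_one]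
    have h2 := congrArg PowerSeries.constantCoeff
      (FaithfulSMul.algebraMap_injective (PowerSeries F) F⸨X⸩ h1)
    rw [map_mul, hφ0, hρ, mul_zero, map_one] at h2
    exact zero_ne_one h2

end PowerSeriesExpansion

/-! ### Valuation rings and ramification -/

section FundamentalInequality

/-- The center of a valuation ring `O` of `K` on a subring `B`. -/
def ValuationSubring.center {K : Type*} [Field K] (O : ValuationSubring K)
    (B : Type*) [CommRing B] [Algebra B K] (h : ∀ b : B, algebraMap B K b ∈ O) : Ideal B :=
  (IsLocalRing.maximalIdeal O).comap ((algebraMap B K).codRestrict O h)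

variable {K : Type*} [Field K] {B : Type*} [CommRing B] [Algebra B K]

theorem ValuationSubring.mem_center (O : ValuationSubring K)
    (h : ∀ b : B, algebraMap B K b ∈ O) {b : B} :
    b ∈ O.center B h ↔ O.valuation (algebraMap B K b) < 1 := by
  exact O.valuation_lt_one_iff ((algebraMap B K).codRestrict O h b)

instance ValuationSubring.center_isPrime (O : ValuationSubring K)
    (h : ∀ b : B, algebraMap B K b ∈ O) : (O.center B h).IsPrime :=
  Ideal.IsPrime.comap _

/-- The localization of `B` at the center lies in `O`. Being a discrete valuation ring, it is
maximal among proper subrings of `K`, and `O ≠ K` because the center is nonzero. -/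
theorem ValuationSubring.eq_of_center [IsDedekindDomain B] [IsFractionRing B K]
    (O : ValuationSubring K) (h : ∀ b : B, algebraMap B K b ∈ O)
    (v : IsDedekindDomain.HeightOneSpectrum B) (hv : v.asIdeal = O.center B h) :
    O = (v.valuation K).valuationSubring := by
  rw [← IsDedekindDomain.HeightOneSpectrum.valuationSubringAtPrime_eq_valuationSubring]
  symm
  apply ValuationSubring.eq_of_le_of_ne_top
  · intro x hx
    rw [IsDedekindDomain.HeightOneSpectrum.valuationSubringAtPrime_eq_valuationSubring,
      Valuation.mem_valuationSubring_iff] at hx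
    obtain ⟨b, s, hs⟩ := v.exists_primeCompl_mul_eq_of_integer x hx
    have hs' : O.valuation (algebraMap B K s) = 1 := by
      refine le_antisymm ((O.valuation_le_one_iff _).mpr (h _)) (not_lt.mp fun hlt ↦ ?_)
      exact s.2 (hv.ge ((O.mem_center h).mpr hlt))
    have hx1 : O.valuation x = O.valuation (algebraMap B K b) := by rw [← hs, map_mul, hs', mul_one]
    rw [← O.valuation_le_one_iff, hx1]
    exact (O.valuation_le_one_iff _).mpr (h _)
  · rintro rfl
    obtain ⟨b, hb, hb0⟩ := Submodule.exists_mem_ne_zero_of_ne_bot v.ne_bot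
    rw [hv, ValuationSubring.mem_center] at hb
    have hb0' : algebraMap B K b ≠ 0 := by simpa using hb0
    have : (⊤ : ValuationSubring K).valuation (algebraMap B K b)⁻¹ ≤ 1 :=
      (ValuationSubring.valuation_le_one_iff _ _).mpr (ValuationSubring.mem_top _)
    rw [map_inv₀] at this
    have h2 := (inv_le_one₀ (by simpa [zero_lt_iff] using hb0')).mp this
    exact absurd hb (not_lt.mpr h2)

/-- The case of equality in the fundamental inequality `∑ eᵢ fᵢ ≤ [K : L]`: if there are at least
`[K : L]` valuation rings of `K` above a principal place `p` of `L`, then `p` is a uniformizer of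
each of them. -/
theorem ValuationSubring.valuation_div_le_one_of_finrank_le_card {A L : Type*} [CommRing A]
    [IsDomain A] [IsPrincipalIdealRing A] [Field L] [Algebra A L] [IsFractionRing A L]
    [Algebra L K] [Algebra A K] [IsScalarTower A L K] [FiniteDimensional L K]
    [Algebra.IsSeparable L K] {ι : Type*} [Finite ι] (O : ι → ValuationSubring K)
    (hO : Function.Injective O) (hA : ∀ i a, algebraMap A K a ∈ O i) {p : A} (hp : Prime p)
    (hpO : ∀ i, (O i).valuation (algebraMap A K p) < 1)
    (hcard : Module.finrank L K ≤ Nat.card ι) (i : ι) {x : K} (hx : (O i).valuation x < 1) :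
    (O i).valuation (x / algebraMap A K p) ≤ 1 := by
  have hAK : Function.Injective (algebraMap A K) := by
    rw [IsScalarTower.algebraMap_eq A L K]
    exact (algebraMap L K).injective.comp (IsFractionRing.injective A L)
  have : FaithfulSMul A K := (faithfulSMul_iff_algebraMap_injective A K).mpr hAK
  have : Module.IsTorsionFree A K := inferInstance
  -- Each `O i` is integrally closed, hence contains `B`; its center on `B` is a prime above `p`
  -- that determines it.
  let B := integralClosure A K
  have : IsDedekindDomain B := IsIntegralClosure.isDedekindDomain A L K B
  have : Module.Finite A B := IsIntegralClosure.finite A L K B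
  have : IsFractionRing B K := integralClosure.isFractionRing_of_finite_extension L K
  have hrank : Module.finrank A B = Module.finrank L K := IsIntegralClosure.rank A L K B
  have hB (i : ι) (b : B) : algebraMap B K b ∈ O i := by
    have hb : IsIntegral (O i) (algebraMap B K b) := by
      obtain ⟨q, hq, hq0⟩ := b.2
      refine ⟨q.map ((algebraMap A K).codRestrict (O i) (hA i)), hq.map _, ?_⟩
      rw [eval₂_map]
      exact hq0
    obtain ⟨y, hy⟩ := IsIntegrallyClosed.isIntegral_iff.mp hb
    rw [← hy]
    exact y.2
  let P : Ideal A := Ideal.span {p}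
  have hP : P.IsMaximal :=
    PrincipalIdealRing.isMaximal_of_irreducible hp.irreducible
  let q (i : ι) : Ideal B := (O i).center B (hB i)
  have hpq (i) : algebraMap A B p ∈ q i := by
    rw [ValuationSubring.mem_center, ← IsScalarTower.algebraMap_apply]
    exact hpO i
  have hpB : algebraMap A B p ≠ 0 := by
    rw [Ne, FaithfulSMul.algebraMap_eq_zero_iff]
    exact hp.ne_zero
  have hq0 (i) : q i ≠ ⊥ := fun h ↦ hpB (by have := hpq i; rwa [h] at this)
  have hqlies (i) : (q i).LiesOver P := by
    refine ⟨hP.eq_of_le (Ideal.IsPrime.comap _).ne_top ?_⟩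
    rw [Ideal.span_singleton_le_iff_mem]
    exact hpq i
  let v (i : ι) : IsDedekindDomain.HeightOneSpectrum B := ⟨q i, inferInstance, hq0 i⟩
  have hv (i) : O i = ((v i).valuation K).valuationSubring := (O i).eq_of_center (hB i) (v i) rfl
  let Q (i : ι) : P.primesOver B := ⟨q i, inferInstance, hqlies i⟩
  have hQ : Function.Injective Q := by
    intro i j hij
    have h1 : v i = v j := IsDedekindDomain.HeightOneSpectrum.ext (congrArg Subtype.val hij)
    apply hO
    rw [hv, hv, h1]
  have : Fintype (P.primesOver B) := (IsDedekindDomain.primesOver_finite P B).fintype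
  have hsum := Ideal.sum_ramification_inertia_eq_finrank P B
  have hpos (r : P.primesOver B) : 1 ≤ r.1.ramificationIdx A * r.1.inertiaDeg A := by
    have := r.2.1
    exact Nat.mul_pos (Ideal.ramificationIdx_pos _ _) (Ideal.inertiaDeg_pos _ _)
  -- The terms `e f` are at least 1 and sum to `[K : L]`, which is at most the number of primes
  -- above `p`; so each term is 1.
  have hone (r : P.primesOver B) : 1 = r.1.ramificationIdx A * r.1.inertiaDeg A := by
    refine (Finset.sum_eq_sum_iff_of_le fun r _ ↦ hpos r).mp ?_ r (Finset.mem_univ r)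
    refine le_antisymm (Finset.sum_le_sum fun r _ ↦ hpos r) ?_
    rw [hsum, hrank, Finset.sum_const, smul_eq_mul, mul_one, Finset.card_univ,
      ← Nat.card_eq_fintype_card]
    exact hcard.trans (Nat.card_le_card_of_injective Q hQ)
  have he : (q i).ramificationIdx A = 1 := Nat.eq_one_of_mul_eq_one_right (hone (Q i)).symm
  have hmap : P.map (algebraMap A B) = Ideal.span {algebraMap A B p} := by
    rw [Ideal.map_span, Set.image_singleton]
  have hp2 : ¬ algebraMap A B p ∈ q i ^ 2 := by
    have hP0 : P.map (algebraMap A B) ≠ ⊥ := by simpa [hmap] using hpB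
    rw [Ideal.IsDedekindDomain.ramificationIdx_eq_multiplicity P (q i) hP0] at he
    have hfin : FiniteMultiplicity (q i) (P.map (algebraMap A B)) :=
      FiniteMultiplicity.of_prime_left (Ideal.prime_of_isPrime (hq0 i) inferInstance) hP0
    have := hfin.not_pow_dvd_of_multiplicity_lt (m := 2) (by omega)
    rwa [hmap, Ideal.dvd_span_singleton] at this
  -- `p` is not in the square of the prime, so its value is at least that of a uniformizer, `exp
  -- (-1)`.
  have hpv : WithZero.exp (-1 : ℤ) ≤ (v i).valuation K (algebraMap A K p) := by
    have h2 : ¬ (v i).intValuation (algebraMap A B p) ≤ WithZero.exp (-(2 : ℕ) : ℤ) := by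
      rw [IsDedekindDomain.HeightOneSpectrum.intValuation_le_pow_iff_mem]
      exact hp2
    have hp0 := (v i).intValuation_ne_zero _ hpB
    rw [IsScalarTower.algebraMap_apply A B K,
      IsDedekindDomain.HeightOneSpectrum.valuation_of_algebraMap, ← WithZero.exp_log hp0,
      WithZero.exp_le_exp]
    rw [← WithZero.exp_log hp0, WithZero.exp_le_exp] at h2
    omega
  -- The two valuations have different value groups; only comparisons with 1 carry over.
  have hmem (y : K) : (O i).valuation y ≤ 1 ↔ (v i).valuation K y ≤ 1 := by
    rw [ValuationSubring.valuation_le_one_iff, ← Valuation.mem_valuationSubring_iff, hv]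
  rw [hmem, map_div₀]
  rcases eq_or_ne x 0 with rfl | hx0
  · simp
  have hxv : (v i).valuation K x < 1 := by
    by_contra! hge
    have h1 : (v i).valuation K x⁻¹ ≤ 1 := by
      rw [map_inv₀]
      exact inv_le_one_of_one_le₀ hge
    rw [← hmem, map_inv₀, inv_le_one₀ (by simpa [zero_lt_iff] using hx0)] at h1
    exact absurd hx (not_lt.mpr h1)
  have hxe : (v i).valuation K x ≤ WithZero.exp (-1 : ℤ) := by
    have hvx : (v i).valuation K x ≠ 0 := by simpa using hx0
    rw [← WithZero.exp_log hvx, ← WithZero.exp_zero, WithZero.exp_lt_exp] at hxv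
    rw [← WithZero.exp_log hvx, WithZero.exp_le_exp]
    omega
  exact div_le_one_of_le₀ (hxe.trans hpv) zero_le

end FundamentalInequality

/-! ### Plane equations and heights -/

section Height

theorem IntermediateField.adjoin_simple_adjoin_simple_eq_top {F K : Type*} [Field F] [Field K]
    [Algebra F K] {a b : K} (hab : IntermediateField.adjoin F {a, b} = ⊤) : F⟮a⟯⟮b⟯ = ⊤ := by
  apply IntermediateField.restrictScalars_injective F
  rw [IntermediateField.adjoin_simple_adjoin_simple, hab, IntermediateField.restrictScalars_top]

theorem IntermediateField.finrank_adjoin_simple_eq_natDegree_minpoly {F K : Type*} [Field F]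
    [Field K] [Algebra F K] {a b : K} (hab : IntermediateField.adjoin F {a, b} = ⊤)
    (hb : IsIntegral F⟮a⟯ b) : Module.finrank F⟮a⟯ K = (minpoly F⟮a⟯ b).natDegree := by
  rw [← IntermediateField.adjoin.finrank hb,
    IntermediateField.adjoin_simple_adjoin_simple_eq_top hab, IntermediateField.finrank_top']

variable {F K : Type*} [Field F] [Field K] [Algebra F K]

theorem RatFunc.algEquivOfTranscendental_comp_algebraMap {a : K} (ha : Transcendental F a) :
    ((algebraMap F⟮a⟯ K).comp
      (RatFunc.algEquivOfTranscendental a ha : RatFunc F →+* F⟮a⟯)).comp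
        (algebraMap F[X] (RatFunc F)) = (aeval a : F[X] →ₐ[F] K).toRingHom := by
  ext p
  · simpa using congrArg Subtype.val ((RatFunc.algEquivOfTranscendental a ha).commutes p)
  · simp

/-- The degree of the defining polynomial of a plane model in one variable is the degree of the
function field over the subfield generated by the other variable. -/
theorem natDegree_eq_finrank_of_irreducible {a b : K} (ha : Transcendental F a)
    (hab : IntermediateField.adjoin F {a, b} = ⊤) {g : F[X][X]}
    (hg : Irreducible (g.map (algebraMap F[X] (RatFunc F))))
    (hroot : g.eval₂ (aeval a : F[X] →ₐ[F] K).toRingHom b = 0) :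
    g.natDegree = Module.finrank F⟮a⟯ K := by
  let e := RatFunc.algEquivOfTranscendental a ha
  let g' : F⟮a⟯[X] := (g.map (algebraMap F[X] (RatFunc F))).map (e : RatFunc F →+* F⟮a⟯)
  have hg' : Irreducible g' :=
    (MulEquiv.irreducible_iff (Polynomial.mapEquiv e.toRingEquiv)).mpr hg
  have hdeg : g'.natDegree = g.natDegree := by
    rw [Polynomial.natDegree_map, Polynomial.natDegree_map_eq_of_injective
      (IsFractionRing.injective F[X] (RatFunc F))]
  have hroot' : aeval b g' = 0 := by
    rw [aeval_def, eval₂_map, eval₂_map]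
    rw [← RatFunc.algEquivOfTranscendental_comp_algebraMap ha] at hroot
    exact hroot
  have hb : IsIntegral F⟮a⟯ b := IsAlgebraic.isIntegral ⟨g', hg'.ne_zero, hroot'⟩
  rw [IntermediateField.finrank_adjoin_simple_eq_natDegree_minpoly hab hb, ← hdeg,
    ← minpoly.eq_of_irreducible hg' hroot', natDegree_mul_C]
  simpa using hg'.ne_zero

/-- Clear denominators in the minimal polynomial and take the primitive part. This is unique up to a
constant in `F`, which is used to make the leading coefficient monic. -/
theorem exists_isMinimalPolynomial {a b : K} (ha : Transcendental F a)
    (hb : IsIntegral F⟮a⟯ b) : ∃ f : F[X][X], IsMinimalPolynomial F a b f := by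
  let e := RatFunc.algEquivOfTranscendental a ha
  let m : (RatFunc F)[X] := (minpoly F⟮a⟯ b).map (e.symm : F⟮a⟯ →+* RatFunc F)
  have hm : Irreducible m :=
    (MulEquiv.irreducible_iff (Polynomial.mapEquiv e.symm.toRingEquiv)).mpr (minpoly.irreducible hb)
  have hme : m.map (e : RatFunc F →+* F⟮a⟯) = minpoly F⟮a⟯ b := by
    rw [Polynomial.map_map]
    convert Polynomial.map_id
    ext x
    simp
  have : NormalizedGCDMonoid F[X] := Classical.choice inferInstance
  let h₀ := IsLocalization.integerNormalization (nonZeroDivisors F[X]) m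
  obtain ⟨d, hd, hdm⟩ := IsLocalization.integerNormalization_spec (nonZeroDivisors F[X]) m
  have hd0 : d ≠ 0 := nonZeroDivisors.ne_zero hd
  have hd0' : algebraMap F[X] (RatFunc F) d ≠ 0 := by simpa using hd0
  rw [algebra_compatible_smul (RatFunc F), smul_eq_C_mul] at hdm
  have hh₀ : h₀ ≠ 0 := by
    intro h0
    change Polynomial.map _ h₀ = _ at hdm
    rw [h0, Polynomial.map_zero] at hdm
    exact mul_ne_zero (by simpa using hd0) hm.ne_zero hdm.symm
  let h₁ := h₀.primPart
  have hass : Associated m (h₁.map (algebraMap F[X] (RatFunc F))) := by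
    change Polynomial.map _ h₀ = _ at hdm
    rw [h₀.eq_C_content_mul_primPart, Polynomial.map_mul, map_C] at hdm
    have hct : algebraMap F[X] (RatFunc F) h₀.content ≠ 0 := by
      simpa [content_eq_zero_iff] using hh₀
    have h1 := associated_unit_mul_left m _ (isUnit_C.mpr hd0'.isUnit)
    rw [← hdm] at h1
    exact h1.symm.trans (associated_unit_mul_left _ _ (isUnit_C.mpr hct.isUnit))
  let c : F := h₁.leadingCoeff.leadingCoeff
  have hc : c ≠ 0 := by simpa [c] using h₀.primPart_ne_zero
  have hu : IsUnit (C (C c⁻¹) : F[X][X]) :=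
    isUnit_C.mpr (isUnit_C.mpr (inv_ne_zero hc).isUnit)
  let f : F[X][X] := C (C c⁻¹) * h₁
  have hf : Associated h₁ f := (associated_unit_mul_left _ _ hu).symm
  have hfm : Associated m (f.map (algebraMap F[X] (RatFunc F))) :=
    hass.trans (hf.map (mapRingHom (algebraMap F[X] (RatFunc F))))
  refine ⟨f, hfm.irreducible hm, ?_, ?_, ?_⟩
  · obtain ⟨w, hw⟩ := hfm
    rw [← RatFunc.algEquivOfTranscendental_comp_algebraMap ha, ← eval₂_map, ← hw, eval₂_mul,
      ← eval₂_map, hme, ← aeval_def, minpoly.aeval, zero_mul]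
  · exact isPrimitive_of_dvd h₀.isPrimitive_primPart hf.dvd'
  · rw [Monic, leadingCoeff_mul, leadingCoeff_mul, leadingCoeff_C, leadingCoeff_C]
    exact inv_mul_cancel₀ hc

/-- Allows the degree in `T` to be computed as a degree in `x`, with the two generators exchanged.
-/
theorem degT_eq_natDegree_swap (f : F[X][X]) : degT f = (Bivariate.swap f).natDegree := by
  have hc (i j : ℕ) : ((Bivariate.swap f).coeff j).coeff i = (f.coeff i).coeff j := by
    induction f using Polynomial.induction_on' with
    | add p q hp hq => simp only [map_add, coeff_add, hp, hq]
    | monomial n p =>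
      rw [Bivariate.swap_monomial, coeff_mul_C, coeff_map, coeff_C_mul_X_pow]
      rw [coeff_monomial]
      split_ifs <;> simp_all
  apply le_antisymm
  · refine Finset.sup_le fun i _ ↦ ?_
    refine natDegree_le_iff_coeff_eq_zero.mpr fun j hj ↦ ?_
    rw [← hc, coeff_eq_zero_of_natDegree_lt hj, coeff_zero]
  · refine natDegree_le_iff_coeff_eq_zero.mpr fun j hj ↦ ?_
    ext i
    rw [hc, coeff_zero]
    by_cases hi : i ∈ f.support
    · exact coeff_eq_zero_of_natDegree_lt ((Finset.le_sup (f := fun i ↦ (f.coeff i).natDegree) hi).trans_lt hj)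
    · rw [notMem_support_iff.mp hi, coeff_zero]

/-- On a curve with function field `F(a, b)`, the height of `b` over `F(a)` is `deg b / deg a`. -/
theorem height_eq_finrank_div_finrank {a b : K} (ha : Transcendental F a)
    (hb : Transcendental F b) (hab : IntermediateField.adjoin F {a, b} = ⊤)
    (hint : IsIntegral F⟮a⟯ b) :
    height F a b = (Module.finrank F⟮b⟯ K : ℚ) / (Module.finrank F⟮a⟯ K : ℚ) := by
  have hex := exists_isMinimalPolynomial ha hint
  rw [height, dif_pos hex]
  have hf := hex.choose_spec
  set f := hex.choose
  -- Gauss's lemma descends irreducibility to `F[T][x]`, where the variables play symmetric roles;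
  -- after the swap it is applied in the other direction.
  have hirr : Irreducible f :=
    (hf.primitive.irreducible_iff_irreducible_map_fraction_map (K := RatFunc F)).mpr hf.irreducible
  have hsirr : Irreducible (Bivariate.swap f) :=
    (MulEquiv.irreducible_iff (Bivariate.swap (R := F))).mpr hirr
  have hev (x y : K) (p : F[X][X]) :
      p.eval₂ (aeval x : F[X] →ₐ[F] K).toRingHom y = aevalAeval x y p := by
    induction p using Polynomial.induction_on' with
    | add p q hp hq => rw [eval₂_add, hp, hq, map_add]
    | monomial n p => simp [← C_mul_X_pow_eq_monomial]
  have hsroot : (Bivariate.swap f).eval₂ (aeval b : F[X] →ₐ[F] K).toRingHom a = 0 := by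
    rw [hev, Bivariate.aevalAeval_swap, ← hev, hf.root]
  -- Otherwise the equation would be a polynomial relation for `b` alone.
  have hsdeg : (Bivariate.swap f).natDegree ≠ 0 := by
    intro h0
    rw [eq_C_of_natDegree_eq_zero h0, eval₂_C] at hsroot
    have h1 : (Bivariate.swap f).coeff 0 = 0 := transcendental_iff.mp hb _ hsroot
    apply hsirr.ne_zero
    rw [eq_C_of_natDegree_eq_zero h0, h1, C_0]
  have hsirr' := ((hsirr.isPrimitive hsdeg).irreducible_iff_irreducible_map_fraction_map
    (K := RatFunc F)).mp hsirr
  rw [degT_eq_natDegree_swap, natDegree_eq_finrank_of_irreducible ha hab hf.irreducible hf.root,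
    natDegree_eq_finrank_of_irreducible hb (by rwa [Set.pair_comm]) hsirr' hsroot]

end Height

/-! ### Unramified algebras over principal ideal rings -/

section LocalRings

theorem MvPolynomial.isPrincipalIdealRing_fin_one {F R : Type*} [Field F] [CommRing R]
    (e : F ≃+* R) : IsPrincipalIdealRing (MvPolynomial (Fin 1) R) := by
  let e' : F[X] ≃+* MvPolynomial (Fin 1) R :=
    (MvPolynomial.uniqueAlgEquiv F (Fin 1)).symm.toRingEquiv.trans (MvPolynomial.mapEquiv (Fin 1) e)
  exact IsPrincipalIdealRing.of_surjective e' e'.surjective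

/-- The local rings of an unramified algebra over a principal ideal ring have principal maximal
ideals. -/
theorem exists_maximalIdeal_eq_span_of_unramified {A S O : Type*} [CommRing A]
    [IsPrincipalIdealRing A] [CommRing S] [Algebra A S] [Algebra.FormallyUnramified A S]
    [Algebra.FiniteType A S] (M : Ideal S) [M.IsPrime] [CommRing O] [IsLocalRing O] [Algebra S O]
    [IsLocalization.AtPrime O M] :
    ∃ ϖ, IsLocalRing.maximalIdeal O = Ideal.span {ϖ} := by
  let p := M.under A
  let := Localization.AtPrime.algebraOfLiesOver p M
  have : Algebra.IsUnramifiedAt A M :=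
    Algebra.FormallyUnramified.comp A S (Localization.AtPrime M)
  obtain ⟨t, ht⟩ := IsPrincipalIdealRing.principal p
  have h1 := ((Algebra.isUnramifiedAt_iff_map_eq A p M).mp inferInstance).2
  let e : Localization.AtPrime M ≃ₐ[S] O := IsLocalization.algEquiv M.primeCompl _ _
  refine ⟨e (algebraMap A _ t), ?_⟩
  have h2 : (IsLocalRing.maximalIdeal (Localization.AtPrime M)).map e =
      IsLocalRing.maximalIdeal O := by
    have := Ideal.map_isMaximal_of_equiv e (p := IsLocalRing.maximalIdeal (Localization.AtPrime M))
    exact IsLocalRing.eq_maximalIdeal this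
  rw [← h2, ← h1, show p = Ideal.span {t} from ht, Ideal.map_span, Ideal.map_span]
  simp

end LocalRings

/-! ### Separatedness and local retractions -/

section Schemes

/-- A separated scheme over an affine base satisfies the uniqueness part of the valuative
criterion. -/
theorem AlgebraicGeometry.Scheme.hom_ext_of_valuationRing {X : Scheme.{u}} {A : CommRingCat.{u}}
    (f : X ⟶ Spec A) [IsSeparated f] {R K : Type u} [CommRing R] [IsDomain R] [ValuationRing R]
    [Field K] [Algebra R K] [IsFractionRing R K] {l₁ l₂ : Spec (CommRingCat.of R) ⟶ X}
    (h : Spec.map (CommRingCat.ofHom (algebraMap R K)) ≫ l₁ =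
      Spec.map (CommRingCat.ofHom (algebraMap R K)) ≫ l₂) : l₁ = l₂ := by
  -- Morphisms to the affine base are ring maps into `R`, and `R` embeds into `K`.
  have hl : l₁ ≫ f = l₂ ≫ f := by
    obtain ⟨a, ha⟩ := Spec.map_surjective (l₁ ≫ f)
    obtain ⟨b, hb⟩ := Spec.map_surjective (l₂ ≫ f)
    have h1 : a ≫ CommRingCat.ofHom (algebraMap R K) = b ≫ CommRingCat.ofHom (algebraMap R K) := by
      apply Spec.map_injective
      rw [Spec.map_comp, Spec.map_comp, ha, hb, reassoc_of% h]
    rw [← ha, ← hb]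
    congr 1
    ext c
    exact IsFractionRing.injective R K (congrArg (fun f ↦ f.hom c) h1)
  let S : ValuativeCommSq f := ⟨R, K, Spec.map (CommRingCat.ofHom (algebraMap R K)) ≫ l₁, l₁ ≫ f,
    ⟨by rw [Category.assoc]⟩⟩
  have hS := IsSeparated.valuativeCriterion f S
  exact congrArg CommSq.LiftStruct.l (hS.elim ⟨l₁, rfl, rfl⟩ ⟨l₂, h.symm, hl.symm⟩)

theorem AlgebraicGeometry.Scheme.germ_top_stalkClosedPointTo {X : Scheme.{u}} {R : CommRingCat.{u}}
    [IsLocalRing R] (f : Spec R ⟶ X) :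
    X.presheaf.germ ⊤ (f (IsLocalRing.closedPoint R)) trivial ≫ Scheme.stalkClosedPointTo f =
      f.appTop ≫ (Scheme.ΓSpecIso R).hom := by
  refine (Scheme.germ_stalkClosedPointTo f ⊤ trivial).trans ?_
  have h : (Spec R).presheaf.map (𝟙 (Opposite.op ⊤)) = 𝟙 _ := (Spec R).presheaf.map_id _
  exact (congrArg (fun g ↦ f.appTop ≫ g ≫ (Scheme.ΓSpecIso R).hom) h).trans
    (congrArg (f.appTop ≫ ·) (Category.id_comp _))

theorem CommRingCat.exists_comp_eq_of_range_subset {R S K : CommRingCat.{u}} (i : R ⟶ K)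
    (j : S ⟶ K) (hi : Function.Injective i.hom) (h : Set.range j.hom ⊆ Set.range i.hom) :
    ∃ e : S ⟶ R, e ≫ i = j := by
  choose e he using fun b ↦ h ⟨b, rfl⟩
  let ε : S →+* R :=
    { toFun := e
      map_one' := hi (by simp [he])
      map_mul' a b := hi (by simp [he])
      map_zero' := hi (by simp [he])
      map_add' a b := hi (by simp [he]) }
  exact ⟨CommRingCat.ofHom ε, CommRingCat.hom_ext (RingHom.ext he)⟩

/-- Both kernels are the unique maximal ideal, and `b` differs from the constant `r' b` by an
element of it. -/
theorem CommRingCat.retraction_unique {F : Type u} [Field F] {R : CommRingCat.{u}} [IsLocalRing R]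
    (s : CommRingCat.of F ⟶ R) {r r' : R ⟶ CommRingCat.of F} (h : s ≫ r = 𝟙 _)
    (h' : s ≫ r' = 𝟙 _) : r = r' := by
  have hs (c : F) : r.hom (s.hom c) = c := congrArg (fun f ↦ f.hom c) h
  have hs' (c : F) : r'.hom (s.hom c) = c := congrArg (fun f ↦ f.hom c) h'
  have hk : RingHom.ker r.hom = RingHom.ker r'.hom := by
    have h1 : (RingHom.ker r.hom).IsMaximal :=
      RingHom.ker_isMaximal_of_surjective (K := F) _ fun c ↦ ⟨s.hom c, hs c⟩
    have h2 : (RingHom.ker r'.hom).IsMaximal :=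
      RingHom.ker_isMaximal_of_surjective (K := F) _ fun c ↦ ⟨s.hom c, hs' c⟩
    rw [IsLocalRing.eq_maximalIdeal h1, IsLocalRing.eq_maximalIdeal h2]
  ext b
  have hb : b - s.hom (r'.hom b) ∈ RingHom.ker r'.hom := by
    rw [RingHom.mem_ker, map_sub, hs', sub_self]
  rw [← hk, RingHom.mem_ker, map_sub, hs, sub_eq_zero] at hb
  exact hb

end Schemes

/-! ### Local rings of the curve -/

namespace SmoothProperCurve

variable {F : Type u} [Field F] (C : SmoothProperCurve F)

/-- The constant functions in the local ring at a point. -/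
noncomputable def constants (x : C.X) : CommRingCat.of F ⟶ C.X.presheaf.stalk x :=
  (Scheme.ΓSpecIso (CommRingCat.of F)).inv ≫ C.π.appTop ≫ C.X.presheaf.germ ⊤ x trivial

/-- The inclusion of the local ring at a point into the function field. -/
noncomputable def toFunctionField (x : C.X) : C.X.presheaf.stalk x ⟶ C.X.functionField :=
  C.X.presheaf.stalkSpecializes ((genericPoint_spec C.X).specializes trivial)

theorem constants_toFunctionField (x : C.X) :
    C.constants x ≫ C.toFunctionField x = C.constants (genericPoint C.X) := by
  rw [constants, toFunctionField, Category.assoc, Category.assoc]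
  exact congrArg (_ ≫ C.π.appTop ≫ ·) (C.X.presheaf.germ_stalkSpecializes (U := ⊤) (y := x) trivial _)

/-- The local ring at a point, as an algebra over the ground field. -/
@[reducible]
noncomputable def stalkAlgebra (x : C.X) : Algebra F (C.X.presheaf.stalk x) :=
  RingHom.toAlgebra (C.constants x).hom

theorem stalkAlgebra_isScalarTower (x : C.X) :
    letI := C.stalkAlgebra x
    IsScalarTower F (C.X.presheaf.stalk x) C.functionField := by
  let := C.stalkAlgebra x
  refine IsScalarTower.of_algebraMap_eq fun c ↦ ?_
  exact congrArg (fun f ↦ f.hom c) (C.constants_toFunctionField x).symm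

/-- Evaluation of germs at a rational point. -/
noncomputable def RationalPoint.eval {C : SmoothProperCurve F} (P : C.RationalPoint) :
    C.X.presheaf.stalk P.point ⟶ CommRingCat.of F :=
  Scheme.stalkClosedPointTo P.1

theorem RationalPoint.constants_eval {C : SmoothProperCurve F} (P : C.RationalPoint) :
    C.constants P.point ≫ P.eval = 𝟙 _ := by
  have h1 : C.X.presheaf.germ ⊤ P.point trivial ≫ P.eval =
      P.1.appTop ≫ (Scheme.ΓSpecIso (CommRingCat.of F)).hom :=
    Scheme.germ_top_stalkClosedPointTo P.1
  rw [constants, Category.assoc, Category.assoc, h1, ← Scheme.Hom.comp_appTop_assoc, P.2]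
  simp

theorem RationalPoint.exists_algHom {C : SmoothProperCurve F} (P : C.RationalPoint) :
    letI := C.stalkAlgebra P.point
    Nonempty (C.X.presheaf.stalk P.point →ₐ[F] F) :=
  letI := C.stalkAlgebra P.point
  ⟨{ P.eval.hom with commutes' := fun c ↦ congrArg (fun f ↦ f.hom c) P.constants_eval }⟩

theorem isNoetherianRing_stalk (x : C.X) : IsNoetherianRing (C.X.presheaf.stalk x) := by
  have := C.proper
  have : IsLocallyNoetherian C.X := LocallyOfFiniteType.isLocallyNoetherian C.π
  infer_instance

/-- Locally a smooth curve is étale over the affine line, whose coordinate ring `F[t]` is principal.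
-/
theorem exists_maximalIdeal_stalk_eq_span (x : C.X) :
    ∃ ϖ, IsLocalRing.maximalIdeal (C.X.presheaf.stalk x) = Ideal.span {ϖ} := by
  have := C.smooth
  obtain ⟨U, hU, V, hV, hx, e, h⟩ :=
    SmoothOfRelativeDimension.exists_isStandardSmoothOfRelativeDimension (n := 1) (f := C.π) x
  let := TopCat.Presheaf.algebra_section_stalk C.X.presheaf (U := V) ⟨x, hx⟩
  have := hV.isLocalization_stalk ⟨x, hx⟩
  have hUtop : U = ⊤ := by
    ext y
    have : y = C.π x := Subsingleton.elim (α := PrimeSpectrum F) _ _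
    simpa [this] using e hx
  obtain ⟨g, -, hg⟩ := h.exists_etale_mvPolynomial
  have : IsPrincipalIdealRing (MvPolynomial (Fin 1) Γ(Spec (CommRingCat.of F), U)) := by
    subst hUtop
    exact MvPolynomial.isPrincipalIdealRing_fin_one
      (Scheme.ΓSpecIso (CommRingCat.of F)).commRingCatIsoToRingEquiv.symm
  algebraize [g]
  exact exists_maximalIdeal_eq_span_of_unramified
    (A := MvPolynomial (Fin 1) Γ(Spec (CommRingCat.of F), U)) (S := Γ(C.X, V))
    (hV.primeIdealOf ⟨x, hx⟩).asIdeal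

/-- A rational point is determined by its local ring inside the function field, if the latter is a
valuation ring. -/
theorem RationalPoint.eq_of_range_subset {C : SmoothProperCurve F} {P Q : C.RationalPoint}
    [ValuationRing (C.X.presheaf.stalk P.point)]
    (h : Set.range (algebraMap (C.X.presheaf.stalk Q.point) C.functionField) ⊆
      Set.range (algebraMap (C.X.presheaf.stalk P.point) C.functionField)) : P = Q := by
  have := C.proper
  have hinj : Function.Injective (C.toFunctionField P.point).hom :=
    IsFractionRing.injective (C.X.presheaf.stalk P.point) C.functionField
  -- The inclusion of local rings gives a second morphism from the spectrum of the local ring at `P`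
  -- to `X`, through `Q`. It agrees with the canonical one at the generic point, hence everywhere;
  -- at the closed point this reads `P = Q`.
  obtain ⟨e, he⟩ := CommRingCat.exists_comp_eq_of_range_subset (C.toFunctionField P.point)
    (C.toFunctionField Q.point) hinj h
  have hs : C.constants Q.point ≫ e = C.constants P.point := by
    ext c
    apply hinj
    have h1 : (C.constants Q.point ≫ e) ≫ C.toFunctionField P.point =
        C.constants P.point ≫ C.toFunctionField P.point := by
      rw [Category.assoc, he, constants_toFunctionField, constants_toFunctionField]
    exact congrArg (fun f ↦ f.hom c) h1
  have hr : e ≫ P.eval = Q.eval := CommRingCat.retraction_unique (C.constants Q.point)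
    (by rw [← Category.assoc, hs, P.constants_eval]) Q.constants_eval
  have hl : Spec.map (C.toFunctionField P.point) ≫ C.X.fromSpecStalk P.point =
      Spec.map (C.toFunctionField P.point) ≫ Spec.map e ≫ C.X.fromSpecStalk Q.point := by
    rw [← Spec.map_comp_assoc, he, toFunctionField, toFunctionField,
      Scheme.SpecMap_stalkSpecializes_fromSpecStalk, Scheme.SpecMap_stalkSpecializes_fromSpecStalk]
  have hll : C.X.fromSpecStalk P.point = Spec.map e ≫ C.X.fromSpecStalk Q.point :=
    Scheme.hom_ext_of_valuationRing C.π (R := C.X.presheaf.stalk P.point) (K := C.functionField) hl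
  have hP : Spec.map P.eval ≫ C.X.fromSpecStalk P.point = P.1 :=
    Scheme.Spec_stalkClosedPointTo_fromSpecStalk P.1
  have hQ : Spec.map Q.eval ≫ C.X.fromSpecStalk Q.point = Q.1 :=
    Scheme.Spec_stalkClosedPointTo_fromSpecStalk Q.1
  apply Subtype.ext
  rw [← hP, ← hQ, hll, ← hr, Spec.map_comp_assoc]

end SmoothProperCurve

/-! ### From places of degree one to embeddings -/

section Places

variable {F K : Type*} [Field F] [Field K] [Algebra F K]

open scoped IntermediateField.algebraAdjoinAdjoin in
/-- If `u` vanishes at `[K : F(u)]` or more places of degree one, it is a uniformizer at each of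
them, so that each of them gives an embedding of `K` into `F((T))` with `u ↦ T`. -/
theorem exists_algHom_laurentSeries_of_places {u : K} (hu : Transcendental F u)
    [FiniteDimensional F⟮u⟯ K] [Algebra.IsSeparable F⟮u⟯ K] {ι : Type*} [Finite ι]
    (R : ι → Type*) [∀ i, CommRing (R i)] [∀ i, IsDomain (R i)]
    [∀ i, IsDiscreteValuationRing (R i)] [∀ i, Algebra F (R i)] [∀ i, Algebra (R i) K]
    [∀ i, IsFractionRing (R i) K] [∀ i, IsScalarTower F (R i) K]
    (hR : ∀ i j, Set.range (algebraMap (R i) K) = Set.range (algebraMap (R j) K) → i = j)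
    (ρ : ∀ i, R i →ₐ[F] F) (g : ∀ i, R i) (hg : ∀ i, g i ∈ IsLocalRing.maximalIdeal (R i))
    (hgu : ∀ i, algebraMap (R i) K (g i) = u)
    (hcard : Module.finrank F⟮u⟯ K ≤ Nat.card ι) :
    ∃ φ : ι → K →ₐ[F] F⸨X⸩, Function.Injective φ ∧ ∀ i, φ i u = HahnSeries.single 1 1 := by
  let A := Algebra.adjoin F {u}
  let e : F[X] ≃ₐ[F] A := Polynomial.algEquivOfTranscendental F u hu
  have : IsPrincipalIdealRing A := IsPrincipalIdealRing.of_surjective e e.surjective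
  let p : A := e X
  have hpu : algebraMap A K p = u := by
    simp [A, p, e]
  have hp : Prime p := (MulEquiv.prime_iff e).mpr Polynomial.prime_X
  let O (i : ι) : ValuationSubring K := (ValuationRing.valuation (R i) K).valuationSubring
  have hO (i : ι) (x : K) : x ∈ O i ↔ x ∈ Set.range (algebraMap (R i) K) :=
    ValuationRing.mem_integer_iff (R i) K x
  have hOinj : Function.Injective O := fun i j hij ↦ hR i j (by
    ext x
    rw [← hO, ← hO, hij])
  have hOA (i : ι) (a : A) : algebraMap A K a ∈ O i := by
    have hle : Algebra.adjoin F {u} ≤ (IsScalarTower.toAlgHom F (R i) K).range := by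
      rw [Algebra.adjoin_le_iff, Set.singleton_subset_iff]
      exact ⟨g i, hgu i⟩
    exact (hO i _).mpr (hle a.2)
  have hOlt (i : ι) {r : R i} (hr : r ∈ IsLocalRing.maximalIdeal (R i)) :
      (O i).valuation (algebraMap (R i) K r) < 1 := by
    rcases eq_or_ne r 0 with rfl | hr0
    · simp
    have hr0' : algebraMap (R i) K r ≠ 0 := by simpa using hr0
    by_contra! hle
    have h1 : (O i).valuation (algebraMap (R i) K r)⁻¹ ≤ 1 := by
      rw [map_inv₀]
      exact inv_le_one_of_one_le₀ hle
    rw [ValuationSubring.valuation_le_one_iff, hO] at h1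
    obtain ⟨s, hs⟩ := h1
    refine hr (IsUnit.of_mul_eq_one s (IsFractionRing.injective (R i) K ?_))
    rw [map_mul, hs, mul_inv_cancel₀ hr0', map_one]
  have hunif (i : ι) : Irreducible (g i) := by
    rw [IsDiscreteValuationRing.irreducible_iff_uniformizer]
    -- By the equality case, `r / u` lies in `R i` for every `r` in the maximal ideal.
    refine le_antisymm (fun r hr ↦ ?_) ((Ideal.span_singleton_le_iff_mem _).mpr (hg i))
    have h1 := ValuationSubring.valuation_div_le_one_of_finrank_le_card (A := A) (L := F⟮u⟯) O
      hOinj hOA hp (fun i ↦ by rw [hpu, ← hgu i]; exact hOlt i (hg i)) hcard i (hOlt i hr)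
    rw [ValuationSubring.valuation_le_one_iff, hO, hpu] at h1
    obtain ⟨s, hs⟩ := h1
    have hu0 : u ≠ 0 := by
      rintro rfl
      exact hu isAlgebraic_zero
    rw [Ideal.mem_span_singleton]
    refine ⟨s, IsFractionRing.injective (R i) K ?_⟩
    rw [map_mul, hs, hgu, mul_div_cancel₀ _ hu0]
  choose φ hφ hφR using fun i ↦ exists_algHom_laurentSeries (K := K) (ρ i) (hunif i)
  -- `R i` is recovered from `φ i` as the preimage of `F[[T]]`.
  refine ⟨φ, fun i j hij ↦ hR i j ?_, fun i ↦ by rw [← hφ i, hgu]⟩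
  ext x
  rw [hφR, hφR, hij]

/-- If `K = F(u, v)` has `[K : F(u)]` embeddings into `F((T))` with `u ↦ T`, all its elements are
totally `u`-adic. -/
theorem isTotallyAdic_of_algHom_laurentSeries {u v : K} [FiniteDimensional F⟮u⟯ K]
    (huv : IntermediateField.adjoin F {u, v} = ⊤) {ι : Type*} [Finite ι] [Nonempty ι]
    {φ : ι → K →ₐ[F] F⸨X⸩} (hφ : Function.Injective φ)
    (hφu : ∀ i, φ i u = HahnSeries.single 1 1) (hcard : Module.finrank F⟮u⟯ K ≤ Nat.card ι)
    (w : K) : IsTotallyAdic F u w := by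
  obtain ⟨i₀⟩ := ‹Nonempty ι›
  let φ₀ : F⟮u⟯ →ₐ[F] F⸨X⸩ := (φ i₀).comp F⟮u⟯.val
  -- All embeddings agree on `F(u)`, so they map `v` to roots of one and the same polynomial over
  -- `F((T))`.
  have hφ₀ (i : ι) : (φ i).comp F⟮u⟯.val = φ₀ := by
    refine IntermediateField.algHom_ext_of_eq_adjoin _ rfl ?_
    rintro x rfl
    exact (hφu i).trans (hφu i₀).symm
  let := (φ₀ : F⟮u⟯ →+* F⸨X⸩).toAlgebra
  have hv : IsIntegral F⟮u⟯ v := Algebra.IsIntegral.isIntegral v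
  have hsplit : ((minpoly F⟮u⟯ v).map (algebraMap F⟮u⟯ F⸨X⸩)).Splits := by
    have := Fintype.ofFinite ι
    have hne : (minpoly F⟮u⟯ v).map (algebraMap F⟮u⟯ F⸨X⸩) ≠ 0 :=
      Polynomial.map_ne_zero (minpoly.ne_zero hv)
    have hroot (i : ι) : φ i v ∈ ((minpoly F⟮u⟯ v).map (algebraMap F⟮u⟯ F⸨X⸩)).roots := by
      rw [mem_roots hne, IsRoot.def, Polynomial.eval_map]
      have h1 := congrArg (φ i) (minpoly.aeval F⟮u⟯ v)
      rw [map_zero, aeval_def] at h1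
      rw [← h1, ← AlgHom.coe_toRingHom, hom_eval₂]
      congr 1
      exact congrArg (fun f : F⟮u⟯ →ₐ[F] F⸨X⸩ ↦ (f : F⟮u⟯ →+* F⸨X⸩)) (hφ₀ i).symm
    have hinj : Function.Injective fun i ↦ φ i v := by
      intro i j hij
      apply hφ
      refine AlgHom.ext fun x ↦ ?_
      have hx : x ∈ IntermediateField.adjoin F {u, v} := huv ▸ IntermediateField.mem_top
      induction hx using IntermediateField.adjoin_induction with
      | mem x hx =>
        rcases hx with rfl | rfl
        · rw [hφu, hφu]
        · exact hij
      | algebraMap x => rw [AlgHom.commutes, AlgHom.commutes]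
      | add x y _ _ hx hy => rw [map_add, map_add, hx, hy]
      | inv x _ hx => rw [map_inv₀, map_inv₀, hx]
      | mul x y _ _ hx hy => rw [map_mul, map_mul, hx, hy]
    rw [splits_iff_card_roots]
    refine le_antisymm (card_roots' _) ?_
    rw [natDegree_map, ← IntermediateField.finrank_adjoin_simple_eq_natDegree_minpoly huv hv]
    refine hcard.trans ?_
    classical
    rw [Nat.card_eq_fintype_card, ← Finset.card_univ, ← Finset.card_image_of_injective _ hinj]
    refine (Finset.card_le_card fun x hx ↦ ?_).trans (Multiset.toFinset_card_le _)
    obtain ⟨i, -, rfl⟩ := Finset.mem_image.mp hx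
    exact Multiset.mem_toFinset.mpr (hroot i)
  refine ⟨Algebra.IsIntegral.isIntegral w, φ₀, hφu i₀, ?_⟩
  have hw : w ∈ F⟮u⟯⟮v⟯ := by
    rw [IntermediateField.adjoin_simple_adjoin_simple_eq_top huv]; trivial
  refine IntermediateField.splits_of_mem_adjoin (F := F⟮u⟯) (L := F⸨X⸩) K ?_ hw
  rintro x rfl
  exact ⟨hv, hsplit⟩

/-- If `u` is algebraic over `F`, then `K` has no place of degree one, unless `K = F(u)`. -/
theorem transcendental_of_algHom {u : K} [FiniteDimensional F⟮u⟯ K]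
    (h1 : Module.finrank F⟮u⟯ K ≠ 1) {R : Type*} [CommRing R] [Algebra F R] [Algebra R K]
    [IsFractionRing R K] [IsScalarTower F R K] (ρ : R →ₐ[F] F) : Transcendental F u := by
  intro hu
  have : FiniteDimensional F F⟮u⟯ := IntermediateField.adjoin.finiteDimensional hu.isIntegral
  -- `K` is now finite over `F`, so `R` is integral over `F`, hence a field equal to `K`. Then `ρ`
  -- is injective, which forces `K = F`.
  have : FiniteDimensional F K := FiniteDimensional.trans F F⟮u⟯ K
  have : IsDomain R := (IsFractionRing.injective R K).isDomain _
  have hRK : Function.Injective (IsScalarTower.toAlgHom F R K) := IsFractionRing.injective R K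
  have : Algebra.IsIntegral F R := ⟨fun x ↦
    (isIntegral_algHom_iff _ hRK).mp (Algebra.IsIntegral.isIntegral _)⟩
  have hfield : IsField R := isField_of_isIntegral_of_isField' (Field.toIsField F)
  let := hfield.toField
  have hsurj : Function.Surjective (algebraMap R K) :=
    IsFractionRing.surjective_iff_isField.mpr hfield
  refine h1 (le_antisymm (finrank_le_one 1 fun w ↦ ?_) Module.finrank_pos)
  obtain ⟨a, rfl⟩ := hsurj w
  have ha : a = algebraMap F R (ρ a) := ρ.toRingHom.injective (by simp)
  refine ⟨algebraMap F F⟮u⟯ (ρ a), ?_⟩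
  rw [ha, ← IsScalarTower.algebraMap_apply, Algebra.smul_def, mul_one,
    ← IsScalarTower.algebraMap_apply]
  simp

end Places

/-! ### The main theorem -/

namespace SmoothProperCurve

variable {F : Type u} [Field F] (C : SmoothProperCurve F)

theorem isDiscreteValuationRing_stalk (x : C.X) (h : ¬ IsField (C.X.presheaf.stalk x)) :
    IsDiscreteValuationRing (C.X.presheaf.stalk x) := by
  have := C.isNoetherianRing_stalk x
  obtain ⟨ϖ, hϖ⟩ := C.exists_maximalIdeal_stalk_eq_span x
  have hprin : (IsLocalRing.maximalIdeal (C.X.presheaf.stalk x)).IsPrincipal := ⟨ϖ, hϖ⟩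
  exact ((IsDiscreteValuationRing.TFAE (C.X.presheaf.stalk x) h).out 0 4).mpr hprin

end SmoothProperCurve

theorem mainTheorem6 {F : Type u} [Field F] [Fintype F] (n : ℕ) (hn : 1 ≤ n)
    (C : SmoothProperCurve F) (u v : C.functionField)
    (hu : C.IsSeparableFunction u) (hv : C.IsSeparableFunction v)
    (hcard : Nat.card C.RationalPoint = n * (Fintype.card F + 1))
    (hdegu : C.degree u = n * (Fintype.card F + 1))
    (hdegv : C.degree v = n)
    (hgen : IntermediateField.adjoin F {u, v} = ⊤)
    (hvan : ∀ P : C.RationalPoint, C.VanishesAt u P.point) :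
    IsTotallyAdicExtension F u (F⟮u⟯)⟮v⟯ ∧
      Module.finrank F⟮u⟯ (F⟮u⟯)⟮v⟯ = n * (Fintype.card F + 1) ∧
      height F u v = 1 / ((Fintype.card F : ℚ) + 1) := by
  have hN : 1 < n * (Fintype.card F + 1) := by
    have := Fintype.card_pos (α := F)
    nlinarith
  have hfu : Module.finrank F⟮u⟯ C.functionField = n * (Fintype.card F + 1) := hdegu
  have hfv : Module.finrank F⟮v⟯ C.functionField = n := hdegv
  -- `Module.finrank` is 0 for an infinite extension, so a positive degree gives finiteness.
  have : FiniteDimensional F⟮u⟯ C.functionField := .of_finrank_pos (by omega)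
  have : FiniteDimensional F⟮v⟯ C.functionField := .of_finrank_pos (by omega)
  have : Algebra.IsSeparable F⟮u⟯ C.functionField := hu
  have : Finite C.RationalPoint := Nat.finite_of_card_ne_zero (by omega)
  have : Nonempty C.RationalPoint := (Nat.card_pos_iff.mp (by omega)).1
  let (P : C.RationalPoint) : Algebra F (C.X.presheaf.stalk P.point) := C.stalkAlgebra P.point
  have (P : C.RationalPoint) : IsScalarTower F (C.X.presheaf.stalk P.point) C.functionField :=
    C.stalkAlgebra_isScalarTower P.point
  let ρ (P : C.RationalPoint) : C.X.presheaf.stalk P.point →ₐ[F] F :=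
    Classical.choice P.exists_algHom
  choose g hg hgu using hvan
  have hut : Transcendental F u := by
    obtain ⟨P₀⟩ := ‹Nonempty C.RationalPoint›
    exact transcendental_of_algHom (by omega) (ρ P₀)
  have hvt : Transcendental F v := by
    intro hva
    have : FiniteDimensional F F⟮v⟯ := IntermediateField.adjoin.finiteDimensional hva.isIntegral
    have : FiniteDimensional F C.functionField := FiniteDimensional.trans F F⟮v⟯ C.functionField
    exact hut (Algebra.IsAlgebraic.isAlgebraic u)
  have hint : IsIntegral F⟮u⟯ v := Algebra.IsIntegral.isIntegral v
  have (P : C.RationalPoint) : IsDiscreteValuationRing (C.X.presheaf.stalk P.point) := by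
    -- In a field the maximal ideal is zero, so vanishing at `P` would mean `u = 0`.
    refine C.isDiscreteValuationRing_stalk P.point fun hfield ↦ ?_
    have hg0 : g P = 0 := by
      by_contra h0
      obtain ⟨y, hy⟩ := hfield.mul_inv_cancel h0
      exact hg P (IsUnit.of_mul_eq_one y hy)
    apply hut
    rw [← hgu P, hg0, map_zero]
    exact isAlgebraic_zero
  have hcard' : Module.finrank F⟮u⟯ C.functionField ≤ Nat.card C.RationalPoint := by
    rw [hfu, hcard]
  obtain ⟨φ, hφ, hφu⟩ := exists_algHom_laurentSeries_of_places hut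
    (fun P : C.RationalPoint ↦ C.X.presheaf.stalk P.point)
    (fun P Q hPQ ↦ SmoothProperCurve.RationalPoint.eq_of_range_subset hPQ.ge) ρ g hg hgu hcard'
  refine ⟨fun w _ ↦ isTotallyAdic_of_algHom_laurentSeries hgen hφ hφu hcard' w, ?_, ?_⟩
  · rw [IntermediateField.adjoin_simple_adjoin_simple_eq_top hgen, IntermediateField.finrank_top',
      hfu]
  · rw [height_eq_finrank_div_finrank hut hvt hgen hint, hfu, hfv]
    have : (n : ℚ) ≠ 0 := by exact_mod_cast (by omega : n ≠ 0)
    push_cast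
    field_simp
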